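/- Let $K$ be a field and $R=K[x_1,\ldots,x_n]$ with its standard grading. For a homogeneous ideal $I\subseteq R$ and $d\ge 0$, let $I_{\langle d\rangle}$ be the ideal of $R$ generated by all homogeneous elements of degree $d$ in $I$. The ideal $I$ is called componentwise linear if for every $d\ge 0$ the ideal $I_{\langle d\rangle}$ has a $d$-linear resolution, i.e. a graded free resolution of the form $$\cdots\to R(-d-2)^{b_2}\to R(-d-1)^{b_1}\to R(-d)^{b_0}\to I_{\langle d\rangle}\to 0$$ with all $b_i$ finite (for $I_{\langle d\rangle}\neq 0$ this means that $I_{\langle d\rangle}$ has Castelnuovo-Mumford regularity $d$; the zero ideal has a $d$-linear resolution for every $d$). For a monomial ideal $I$, let $\mathcal{G}(I)$ denote its unique minimal set of monomial generators. Let $I\subseteq R$ be a componentwise linear monomial ideal, let $x\in\{x_1,\ldots,x_n\}$ be a variable, and let $I'$ be the ideal of $R$ generated by $\mathcal{G}(I)\setminus\{u\in\mathcal{G}(I) : x\mid u\}$ (so $I'=0$ if $x$ divides every element of $\mathcal{G}(I)$). Then $I'$ is also componentwise linear. -/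

import Mathlib

open MvPolynomial

/-- `I` is a monomial ideal: it is generated by a set of monomials. -/
def IsMonomialIdeal {σ K : Type*} [Field K] (I : Ideal (MvPolynomial σ K)) : Prop :=
  ∃ S : Set (σ →₀ ℕ), I = Ideal.span ((fun a => monomial a (1 : K)) '' S)

/-- The minimal monomial generating set `𝒢(I)` of a monomial ideal `I`: the monomials of `I` that
are minimal with respect to divisibility among all monomials of `I`. (The order on exponent
vectors is componentwise, which is divisibility of monomials.) -/
noncomputable def minimalGenerators {σ K : Type*} [Field K] (I : Ideal (MvPolynomial σ K)) :
    Set (MvPolynomial σ K) :=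
  (fun a => monomial a (1 : K)) ''
    {a : σ →₀ ℕ | Minimal (fun b : σ →₀ ℕ => monomial b (1 : K) ∈ I) a}

/-- The ideal `I_⟨d⟩` generated by the homogeneous elements of degree `d` of `I`. -/
noncomputable def degreePartIdeal {σ K : Type*} [Field K] (I : Ideal (MvPolynomial σ K)) (d : ℕ) :
    Ideal (MvPolynomial σ K) :=
  Ideal.span {f | f ∈ I ∧ f.IsHomogeneous d}

/-- A `d`-linear resolution of the ideal `J` of the polynomial ring `R`, that is, a graded free
resolution of the form
`⋯ → R(-d-2)^(b 2) → R(-d-1)^(b 1) → R(-d)^(b 0) → J → 0`.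
The augmentation `R(-d)^(b 0) → J` is given by homogeneous generators of `J` of degree `d`, and
the differential `R(-d-i-1)^(b (i+1)) → R(-d-i)^(b i)` by a matrix whose entries are linear forms
(possibly zero). No entry of these matrices is a nonzero constant, so such a resolution is
automatically the minimal graded free resolution of `J`. -/
structure LinearResolution {σ K : Type*} [Field K] (J : Ideal (MvPolynomial σ K)) (d : ℕ) where
  /-- The ranks of the free modules. -/
  rank : ℕ → ℕ
  /-- The images in `J` of the basis vectors of the free module in homological degree `0`. -/
  gen : Fin (rank 0) → MvPolynomial σ K
  /-- The matrix of the map from homological degree `i + 1` to homological degree `i`. -/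
  diff : ∀ i : ℕ, Matrix (Fin (rank i)) (Fin (rank (i + 1))) (MvPolynomial σ K)
  gen_isHomogeneous : ∀ k, (gen k).IsHomogeneous d
  diff_isHomogeneous : ∀ i r c, (diff i r c).IsHomogeneous 1
  span_gen : Ideal.span (Set.range gen) = J
  exact_zero : Function.Exact (diff 0).mulVecLin
    (Fintype.linearCombination (MvPolynomial σ K) gen)
  exact_succ : ∀ i : ℕ, Function.Exact (diff (i + 1)).mulVecLin (diff i).mulVecLin

/-- `J` has a `d`-linear resolution. The zero ideal has one for every `d`, namely the zero
complex. For `J ≠ 0` this says that the graded Betti numbers `β_{i,j}(J)` vanish for `j ≠ i + d`,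
that is, that `J` is generated in degree `d` and has regularity `d`. -/
def HasLinearResolution {σ K : Type*} [Field K] (J : Ideal (MvPolynomial σ K)) (d : ℕ) : Prop :=
  Nonempty (LinearResolution J d)

/-- `I` is componentwise linear: it is homogeneous (for the standard grading,
i.e. it contains the homogeneous components of its elements), and `I_⟨d⟩` has a
`d`-linear resolution for every `d ≥ 0`. -/
def IsComponentwiseLinear {σ K : Type*} [Field K] (I : Ideal (MvPolynomial σ K)) : Prop :=
  (∀ f ∈ I, ∀ k : ℕ, homogeneousComponent k f ∈ I) ∧
    ∀ d : ℕ, HasLinearResolution (degreePartIdeal I d) d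

/-! Koszul homology replaces resolutions. Grade Koszul chains by the degree of their coefficients. A
homogeneous ideal J has a d-linear resolution exactly when its Koszul homology is concentrated in
coefficient degree d (`LinearResolution.koszulLinear`, `hasLinearResolution_of_koszulLinear`). Both
directions are dimension shifting along 0 → Z → F → N → 0 with F free, whose Koszul complex is exact
in positive coefficient degrees.

It remains to compare N = I_⟨d⟩ with N' = I'_⟨d⟩. The ideal I' is spanned by the multiples of the
x-free monomials of I, so N' ⊆ N and the two have the same x-free monomials. Restriction of a chain
to its x-free part is a chain map, and division by x followed by the wedge with the basis vector of
x is a homotopy from it to the identity. Let c be a cycle in N' of coefficient degree a ≠ d. If a <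
d, then c = 0. If a > d, division by x keeps the coefficients in N', so c is homologous within N' to
its restriction. That restriction bounds some w in N by linearity of N, hence bounds the restriction
of w, which lies in N' (`KoszulLinear.of_vecDiv_mem`). -/

/-! ### The Koszul differential -/

section Koszul

variable {σ K M : Type*} [Field K] [LinearOrder σ]

/-- The sign of the basis vector `i` in the wedge product of `i` with the increasing product of the
elements of `T`. -/
def koszulSign (i : σ) (T : Finset σ) : ℤ := (-1) ^ (T.filter (· < i)).card

theorem koszulSign_mul_self (i : σ) (T : Finset σ) : koszulSign i T * koszulSign i T = 1 := by
  rw [koszulSign, ← mul_pow]; simp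

theorem koszulSign_insert (i : σ) {j : σ} {T : Finset σ} (hj : j ∉ T) :
    koszulSign i (insert j T) = if j < i then -koszulSign i T else koszulSign i T := by
  unfold koszulSign
  rw [Finset.filter_insert]
  split_ifs with h
  · rw [Finset.card_insert_of_notMem (by simp [hj]), pow_succ]; simp
  · rfl

theorem koszulSign_comm {i j : σ} {T : Finset σ} (hij : i ≠ j) (hi : i ∉ T) (hj : j ∉ T) :
    koszulSign i T * koszulSign j (insert i T) =
      -(koszulSign j T * koszulSign i (insert j T)) := by
  rw [koszulSign_insert j hi, koszulSign_insert i hj]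
  rcases lt_or_gt_of_ne hij with h | h
  · simp [h, h.not_gt, mul_comm]
  · simp [h, h.not_gt, mul_comm]

theorem koszulSign_insert_mul_koszulSign_insert {i j : σ} {T : Finset σ} (hij : i ≠ j)
    (hi : i ∉ T) (hj : j ∉ T) :
    koszulSign i (insert j T) * koszulSign j (insert i T) =
      -(koszulSign j T * koszulSign i T) := by
  rw [koszulSign_insert j hi, koszulSign_insert i hj]
  rcases lt_or_gt_of_ne hij with h | h
  · simp [h, h.not_gt, mul_comm]
  · simp [h, h.not_gt, mul_comm]

/-- Swapping the indices pairs off the terms. The diagonal needs its own hypothesis because `A` may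
have 2-torsion. -/
theorem Finset.sum_sum_eq_zero_of_antisymm {ι A : Type*} [AddCommGroup A] (s : Finset ι)
    (f : ι → ι → A) (h0 : ∀ i, f i i = 0) (h : ∀ i j, f i j = -f j i) :
    ∑ i ∈ s, ∑ j ∈ s, f i j = 0 := by
  rw [← Finset.sum_product']
  refine Finset.sum_involution (fun p _ => p.swap) ?_ ?_ ?_ ?_
  · rintro ⟨i, j⟩ _
    simp [h i j]
  · rintro ⟨i, j⟩ _ hne heq
    simp only [Prod.swap_prod_mk, Prod.mk.injEq] at heq
    exact hne (by rw [heq.1]; exact h0 _)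
  · rintro ⟨i, j⟩ hp
    simpa [and_comm] using hp
  · rintro ⟨i, j⟩ _
    rfl

variable [Fintype σ] [AddCommGroup M] [Module (MvPolynomial σ K) M]

/-- The Koszul differential with coefficients in `M`. A chain is given by its coefficients with
respect to the basis of the exterior algebra indexed by the finite sets of variables. -/
noncomputable def koszulD : (Finset σ → M) →ₗ[MvPolynomial σ K] (Finset σ → M) where
  toFun c T := ∑ i, if i ∈ T then 0 else
    koszulSign i T • (X i : MvPolynomial σ K) • c (insert i T)
  map_add' c c' := by
    funext T
    rw [Pi.add_apply, ← Finset.sum_add_distrib]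
    refine Finset.sum_congr rfl fun i _ => ?_
    split_ifs <;> simp
  map_smul' r c := by
    funext T
    rw [Pi.smul_apply, RingHom.id_apply, Finset.smul_sum]
    refine Finset.sum_congr rfl fun i _ => ?_
    split_ifs
    · simp
    · rw [Pi.smul_apply, smul_comm (X i) r, smul_comm _ r]

theorem koszulD_apply (c : Finset σ → M) (T : Finset σ) :
    koszulD (K := K) c T = ∑ i, if i ∈ T then 0 else
      koszulSign i T • (X i : MvPolynomial σ K) • c (insert i T) := rfl

theorem koszulD_koszulD (c : Finset σ → M) : koszulD (K := K) (koszulD (K := K) c) = 0 := by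
  funext T
  have key : ∀ i j : σ, i ≠ j → i ∉ T → j ∉ T →
      koszulSign i T • (X i : MvPolynomial σ K) • koszulSign j (insert i T) •
        (X j : MvPolynomial σ K) • c (insert j (insert i T)) =
      -(koszulSign j T • (X j : MvPolynomial σ K) • koszulSign i (insert j T) •
        (X i : MvPolynomial σ K) • c (insert i (insert j T))) := by
    intro i j hij hi hj
    rw [smul_comm (X i) (koszulSign j (insert i T)), smul_comm (X j) (koszulSign i (insert j T)),
      ← mul_smul (koszulSign i T), ← mul_smul (koszulSign j T), koszulSign_comm hij hi hj,
      neg_smul, smul_comm (X i) (X j), Finset.insert_comm]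
  -- Setting the degenerate pairs to zero lets the sum run over all ordered pairs, where it is
  -- antisymmetric.
  have : koszulD (K := K) (koszulD (K := K) c) T = ∑ i, ∑ j,
      if i ∈ T ∨ j ∈ T ∨ i = j then 0 else
        koszulSign i T • (X i : MvPolynomial σ K) • koszulSign j (insert i T) •
          (X j : MvPolynomial σ K) • c (insert j (insert i T)) := by
    rw [koszulD_apply]
    refine Finset.sum_congr rfl fun i _ => ?_
    split_ifs with hi
    · simp [hi]
    · rw [koszulD_apply, Finset.smul_sum, Finset.smul_sum]
      refine Finset.sum_congr rfl fun j _ => ?_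
      by_cases hj : j ∈ T
      · simp [hj]
      · by_cases hij : i = j
        · simp [hij]
        · simp [hi, hj, hij, Ne.symm hij]
  rw [this, Pi.zero_apply]
  refine Finset.sum_sum_eq_zero_of_antisymm _ _ (by simp) fun i j => ?_
  by_cases hi : i ∈ T
  · simp [hi]
  · by_cases hj : j ∈ T
    · simp [hj]
    · by_cases hij : i = j
      · simp [hij]
      · rw [if_neg (by tauto), if_neg (by tauto)]
        exact key i j hij hi hj

theorem koszulD_map {N : Type*} [AddCommGroup N] [Module (MvPolynomial σ K) N]
    (f : M →ₗ[MvPolynomial σ K] N) (c : Finset σ → M) :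
    koszulD (K := K) (fun T => f (c T)) = fun T => f (koszulD (K := K) c T) := by
  funext T
  rw [koszulD_apply, koszulD_apply, map_sum]
  refine Finset.sum_congr rfl fun i _ => ?_
  split_ifs <;> simp

theorem koszulD_mem {N : Submodule (MvPolynomial σ K) M} {c : Finset σ → M} (hc : ∀ T, c T ∈ N)
    (T : Finset σ) : koszulD (K := K) c T ∈ N := by
  rw [koszulD_apply]
  refine Submodule.sum_mem _ fun i _ => ?_
  split_ifs
  · exact N.zero_mem
  · exact zsmul_mem (N.smul_mem _ (hc _)) _

theorem koszulD_eq_zero_of_card {c : Finset σ → M} {p : ℕ}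
    (hc : ∀ T : Finset σ, p + 1 ≤ T.card → c T = 0) (T : Finset σ) (hT : p ≤ T.card) :
    koszulD (K := K) c T = 0 := by
  rw [koszulD_apply]
  refine Finset.sum_eq_zero fun i _ => ?_
  split_ifs with h
  · rfl
  · rw [hc _ (by rw [Finset.card_insert_of_notMem h]; omega)]; simp

/-! ### The contraction with respect to a variable -/

/-- A decomposition of `M` with respect to the variable `x`: `r` is the remainder and `q` the
quotient of the division by `x`. -/
structure DivisionBy (x : σ) (q r : M →+ M) : Prop where
  eq_add : ∀ m, m = r m + (X x : MvPolynomial σ K) • q m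
  q_smul : ∀ m, q ((X x : MvPolynomial σ K) • m) = m
  r_smul : ∀ m, r ((X x : MvPolynomial σ K) • m) = 0
  q_smul_of_ne : ∀ y, y ≠ x → ∀ m, q ((X y : MvPolynomial σ K) • m) =
    (X y : MvPolynomial σ K) • q m
  r_smul_of_ne : ∀ y, y ≠ x → ∀ m, r ((X y : MvPolynomial σ K) • m) =
    (X y : MvPolynomial σ K) • r m

/-- The restriction of a chain to the part of degree zero in the variable `x`. -/
def koszulRestrict (x : σ) (r : M →+ M) (c : Finset σ → M) : Finset σ → M :=
  fun T => if x ∈ T then 0 else r (c T)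

/-- The contracting homotopy that divides by `x` and takes the wedge product with the basis vector
of `x`. -/
def koszulContract (x : σ) (q : M →+ M) (c : Finset σ → M) : Finset σ → M :=
  fun T => if x ∈ T then koszulSign x (T.erase x) • q (c (T.erase x)) else 0

theorem koszulD_koszulRestrict {x : σ} {q r : M →+ M} (h : DivisionBy (K := K) x q r)
    (c : Finset σ → M) :
    koszulD (K := K) (koszulRestrict x r c) = koszulRestrict x r (koszulD (K := K) c) := by
  funext T
  rw [koszulD_apply]
  unfold koszulRestrict
  by_cases hx : x ∈ T
  · simp [hx]
  · rw [if_neg hx, koszulD_apply, map_sum]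
    refine Finset.sum_congr rfl fun i _ => ?_
    by_cases hi : i ∈ T
    · simp [hi]
    · rcases eq_or_ne i x with rfl | hix
      · simp [hx, h.r_smul, map_zsmul]
      · simp [hx, hi, hix.symm, h.r_smul_of_ne i hix, map_zsmul]

/-- The homotopy formula Dh + hD = id − restriction, evaluated on a cycle. -/
theorem koszulD_koszulContract {x : σ} {q r : M →+ M} (h : DivisionBy (K := K) x q r)
    {c : Finset σ → M} (hc : koszulD (K := K) c = 0) :
    koszulD (K := K) (koszulContract x q c) = c - koszulRestrict x r c := by
  funext T
  rw [Pi.sub_apply, koszulD_apply]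
  unfold koszulRestrict koszulContract
  by_cases hx : x ∈ T
  · rw [if_pos hx, sub_zero]
    obtain ⟨S, hxS, rfl⟩ : ∃ S, x ∉ S ∧ insert x S = T :=
      ⟨T.erase x, by simp, Finset.insert_erase hx⟩
    -- This is the term hD of the homotopy formula, zero on a cycle. Added to Dh, it cancels every
    -- summand with `i ≠ x`, and its summand at `x` gives back `c (insert x S)`.
    have h0 : koszulSign x S • q (koszulD (K := K) c S) = 0 := by simp [hc]
    rw [koszulD_apply, map_sum, Finset.smul_sum] at h0
    refine (left_eq_add.mpr h0).trans ?_
    rw [← Finset.sum_add_distrib, Finset.sum_eq_single_of_mem x (Finset.mem_univ _)]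
    · simp only [Finset.mem_insert_self, if_true, zero_add, if_neg hxS]
      rw [map_zsmul, smul_smul, koszulSign_mul_self, one_smul, h.q_smul]
    · intro i _ hix
      by_cases hi : i ∈ S
      · simp [hi]
      · have hi' : i ∉ insert x S := by simp [hi, hix]
        rw [if_neg hi', if_neg hi, if_pos (by simp), Finset.insert_comm,
          Finset.erase_insert (by simp [hxS, hix.symm]), map_zsmul, h.q_smul_of_ne i hix,
          smul_comm (X i : MvPolynomial σ K) (koszulSign x _), smul_smul, smul_smul,
          koszulSign_insert_mul_koszulSign_insert hix hi hxS, neg_smul, neg_add_cancel]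
  -- For `x ∉ T` only inserting `x` meets the support of the contraction; it contributes x · q(c T)
  -- = c T − r(c T).
  · rw [if_neg hx, Finset.sum_eq_single_of_mem x (Finset.mem_univ _)]
    · rw [if_neg hx, if_pos (by simp), Finset.erase_insert hx,
        smul_comm (X x : MvPolynomial σ K) (koszulSign x _), smul_smul, koszulSign_mul_self,
        one_smul, eq_sub_iff_add_eq, add_comm]
      exact (h.eq_add _).symm
    · intro i _ hix
      simp [hx, hix.symm]

end Koszul

/-! ### Graded pieces of free modules -/

section Graded

variable {σ K ι : Type*} [Field K]

theorem MvPolynomial.IsHomogeneous.homogeneousComponent_add_mul {g : MvPolynomial σ K} {d : ℕ}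
    (hg : g.IsHomogeneous d) (f : MvPolynomial σ K) (b : ℕ) :
    homogeneousComponent (b + d) (f * g) = homogeneousComponent b f * g := by
  conv_lhs => rw [← sum_homogeneousComponent f, Finset.sum_mul, map_sum]
  rw [Finset.sum_congr rfl fun i _ => homogeneousComponent_of_mem
    (((homogeneousComponent_isHomogeneous i f).mul hg))]
  simp only [add_left_inj, eq_comm (a := b)]
  rw [Finset.sum_ite_eq']
  split_ifs with h
  · rfl
  · rw [homogeneousComponent_eq_zero, zero_mul]
    simp only [Finset.mem_range] at h
    omega

theorem MvPolynomial.IsHomogeneous.homogeneousComponent_mul_eq_zero {g : MvPolynomial σ K} {d : ℕ}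
    (hg : g.IsHomogeneous d) (f : MvPolynomial σ K) {b : ℕ} (hb : b < d) :
    homogeneousComponent b (f * g) = 0 := by
  conv_lhs => rw [← sum_homogeneousComponent f, Finset.sum_mul, map_sum]
  refine Finset.sum_eq_zero fun i _ => ?_
  rw [homogeneousComponent_of_mem ((homogeneousComponent_isHomogeneous i f).mul hg),
    if_neg (by omega)]

/-- The homogeneous component of degree `a` of a vector of polynomials. -/
noncomputable def vecComponent (a : ℕ) : (ι → MvPolynomial σ K) →ₗ[K] (ι → MvPolynomial σ K) :=
  LinearMap.pi fun k => (homogeneousComponent a).comp (LinearMap.proj k)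

@[simp]
theorem vecComponent_apply (a : ℕ) (v : ι → MvPolynomial σ K) (k : ι) :
    vecComponent a v k = homogeneousComponent a (v k) := rfl

/-- A vector of polynomials is homogeneous of degree `a` if all its entries are. -/
def VecHomogeneous (a : ℕ) (v : ι → MvPolynomial σ K) : Prop := ∀ k, (v k).IsHomogeneous a

theorem vecHomogeneous_vecComponent (a : ℕ) (v : ι → MvPolynomial σ K) :
    VecHomogeneous a (vecComponent a v) := fun k => homogeneousComponent_isHomogeneous a (v k)

theorem VecHomogeneous.vecComponent_eq {a : ℕ} {v : ι → MvPolynomial σ K}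
    (h : VecHomogeneous a v) : vecComponent a v = v :=
  funext fun k => homogeneousComponent_eq_self (h k)

/-- The graded submodules of a finite free module. -/
def IsGraded (N : Submodule (MvPolynomial σ K) (ι → MvPolynomial σ K)) : Prop :=
  ∀ v ∈ N, ∀ a, vecComponent a v ∈ N

theorem exists_sum_vecComponent [Finite ι] (v : ι → MvPolynomial σ K) :
    ∃ m, ∑ a ∈ Finset.range m, vecComponent a v = v := by
  have := Fintype.ofFinite ι
  refine ⟨(Finset.univ.sup fun k => (v k).totalDegree) + 1, funext fun k => ?_⟩
  have hk : (v k).totalDegree + 1 ≤ (Finset.univ.sup fun k => (v k).totalDegree) + 1 :=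
    Nat.succ_le_succ (Finset.le_sup (f := fun k => (v k).totalDegree) (Finset.mem_univ k))
  rw [Finset.sum_apply]
  conv_rhs => rw [← sum_homogeneousComponent (v k)]
  refine (Finset.sum_subset (Finset.range_subset_range.mpr hk) fun a _ ha => ?_).symm
  rw [vecComponent_apply, homogeneousComponent_eq_zero]
  simp only [Finset.mem_range] at ha
  omega

section LinearCombination

variable {κ : Type*} [Fintype κ] {g : κ → ι → MvPolynomial σ K} {d : ℕ}

theorem linearCombination_apply_apply (v : κ → MvPolynomial σ K) (k : ι) :
    Fintype.linearCombination (MvPolynomial σ K) g v k = ∑ j, v j * g j k := by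
  simp [Fintype.linearCombination_apply]

theorem linearCombination_vecComponent (hg : ∀ j, VecHomogeneous d (g j))
    (v : κ → MvPolynomial σ K) (b : ℕ) :
    Fintype.linearCombination (MvPolynomial σ K) g (vecComponent b v) =
      vecComponent (b + d) (Fintype.linearCombination (MvPolynomial σ K) g v) := by
  funext k
  rw [vecComponent_apply, linearCombination_apply_apply, linearCombination_apply_apply, map_sum]
  exact Finset.sum_congr rfl fun j _ => ((hg j k).homogeneousComponent_add_mul _ _).symm

theorem vecComponent_linearCombination_of_lt (hg : ∀ j, VecHomogeneous d (g j))
    (v : κ → MvPolynomial σ K) {b : ℕ} (hb : b < d) :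
    vecComponent b (Fintype.linearCombination (MvPolynomial σ K) g v) = 0 := by
  funext k
  rw [vecComponent_apply, linearCombination_apply_apply, map_sum]
  exact Finset.sum_eq_zero fun j _ => (hg j k).homogeneousComponent_mul_eq_zero _ hb

theorem isGraded_ker_linearCombination (hg : ∀ j, VecHomogeneous d (g j)) :
    IsGraded (LinearMap.ker (Fintype.linearCombination (MvPolynomial σ K) g)) := by
  intro v hv b
  rw [LinearMap.mem_ker] at hv ⊢
  rw [linearCombination_vecComponent hg, hv, map_zero]

theorem VecHomogeneous.linearCombination (hg : ∀ j, VecHomogeneous d (g j))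
    {v : κ → MvPolynomial σ K} {b : ℕ} (hv : VecHomogeneous b v) :
    VecHomogeneous (b + d) (Fintype.linearCombination (MvPolynomial σ K) g v) := by
  rw [← hv.vecComponent_eq, linearCombination_vecComponent hg]
  exact vecHomogeneous_vecComponent _ _

/-- The hypotheses on `v` stand under the existential so that `choose` yields a lift depending on
`v` alone. Lifting 0 to 0 preserves the vanishing of a chain on large sets. -/
theorem exists_linearCombination_eq_of_vecHomogeneous (hg : ∀ j, VecHomogeneous d (g j)) {a : ℕ}
    (v : ι → MvPolynomial σ K) : ∃ u : κ → MvPolynomial σ K,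
      v ∈ LinearMap.range (Fintype.linearCombination (MvPolynomial σ K) g) →
        VecHomogeneous (a + d) v →
        VecHomogeneous a u ∧ Fintype.linearCombination (MvPolynomial σ K) g u = v ∧
          (v = 0 → u = 0) := by
  by_cases h0 : v = 0
  · subst h0
    exact ⟨0, fun _ _ => ⟨fun _ => isHomogeneous_zero _ _ _, map_zero _, fun _ => rfl⟩⟩
  · by_cases h : v ∈ LinearMap.range (Fintype.linearCombination (MvPolynomial σ K) g)
    · obtain ⟨u, rfl⟩ := h
      exact ⟨vecComponent a u, fun _ hv => ⟨vecHomogeneous_vecComponent a u, by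
        rw [linearCombination_vecComponent hg, hv.vecComponent_eq], fun h => absurd h h0⟩⟩
    · exact ⟨0, fun h' => absurd h' h⟩

end LinearCombination

end Graded

/-! ### Acyclicity of the Koszul complex of a free module -/

section Acyclic

variable {σ K ι : Type*} [Field K]

/-- The quotient in the division of a vector of polynomials by the variable `x`. -/
noncomputable def vecDiv (x : σ) : (ι → MvPolynomial σ K) →+ (ι → MvPolynomial σ K) where
  toFun v k := (v k).divMonomial (Finsupp.single x 1)
  map_zero' := funext fun _ => zero_divMonomial _
  map_add' _ _ := funext fun _ => add_divMonomial _ _ _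

/-- The remainder in the division of a vector of polynomials by the variable `x`. -/
noncomputable def vecMod (x : σ) : (ι → MvPolynomial σ K) →+ (ι → MvPolynomial σ K) :=
  AddMonoidHom.id _ - ((LinearMap.lsmul (MvPolynomial σ K) _ (X x)).toAddMonoidHom.comp (vecDiv x))

theorem vecMod_eq_sub (x : σ) (v : ι → MvPolynomial σ K) :
    vecMod x v = v - (X x : MvPolynomial σ K) • vecDiv x v := rfl

theorem coeff_vecDiv (x : σ) (v : ι → MvPolynomial σ K) (k : ι) (m : σ →₀ ℕ) :
    coeff m (vecDiv x v k) = coeff (Finsupp.single x 1 + m) (v k) := coeff_divMonomial _ _ _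

theorem coeff_vecMod (x : σ) (v : ι → MvPolynomial σ K) (k : ι) (m : σ →₀ ℕ) :
    coeff m (vecMod x v k) = if m x = 0 then coeff m (v k) else 0 := by
  have : vecMod x v k = (v k).modMonomial (Finsupp.single x 1) := by
    rw [vecMod_eq_sub, Pi.sub_apply, sub_eq_iff_eq_add]
    exact (modMonomial_add_divMonomial_single (v k) x).symm
  rw [this]
  split_ifs with h
  · exact coeff_modMonomial_of_not_le _ (by simp [h])
  · exact coeff_modMonomial_of_le _ (by simpa using Nat.one_le_iff_ne_zero.mpr h)

theorem vecDiv_smul_of_ne {x y : σ} (h : y ≠ x) (v : ι → MvPolynomial σ K) :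
    vecDiv x ((X y : MvPolynomial σ K) • v) = (X y : MvPolynomial σ K) • vecDiv x v := by
  classical
  funext k
  ext m
  rw [coeff_vecDiv, Pi.smul_apply, Pi.smul_apply, smul_eq_mul, smul_eq_mul, coeff_X_mul',
    coeff_X_mul', coeff_vecDiv]
  have hy : y ∈ (Finsupp.single x 1 + m).support ↔ y ∈ m.support := by
    simp [h.symm]
  by_cases hm : y ∈ m.support
  · rw [if_pos (hy.mpr hm), if_pos hm, add_tsub_assoc_of_le]
    simpa [Nat.one_le_iff_ne_zero] using hm
  · rw [if_neg (hy.not.mpr hm), if_neg hm]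

theorem divisionBy_vecDiv_vecMod (x : σ) :
    DivisionBy (K := K) (M := ι → MvPolynomial σ K) x (vecDiv x) (vecMod x) where
  eq_add v := by rw [vecMod_eq_sub, sub_add_cancel]
  q_smul v := _root_.funext fun k => X_mul_divMonomial _ _
  r_smul v := by
    rw [vecMod_eq_sub, sub_eq_zero]
    congr 1
    exact (_root_.funext fun k => X_mul_divMonomial _ _).symm
  q_smul_of_ne y h v := vecDiv_smul_of_ne h v
  r_smul_of_ne y h v := by
    rw [vecMod_eq_sub, vecMod_eq_sub, vecDiv_smul_of_ne h, smul_sub, smul_comm]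

theorem VecHomogeneous.vecMod {a : ℕ} {v : ι → MvPolynomial σ K} (h : VecHomogeneous a v) (x : σ) :
    VecHomogeneous a (vecMod x v) := by
  intro k m hm
  rw [coeff_vecMod] at hm
  split_ifs at hm with hx
  · exact h k hm
  · exact absurd rfl hm

variable [Fintype σ] [LinearOrder σ]

theorem koszulD_vecComponent (c : Finset σ → ι → MvPolynomial σ K) (a : ℕ) :
    koszulD (K := K) (fun T => vecComponent a (c T)) =
      fun T => vecComponent (a + 1) (koszulD (K := K) c T) := by
  funext T k
  rw [koszulD_apply, koszulD_apply, map_sum, Finset.sum_apply, Finset.sum_apply]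
  refine Finset.sum_congr rfl fun i _ => ?_
  split_ifs
  · simp
  · rw [map_zsmul, Pi.smul_apply, Pi.smul_apply, Pi.smul_apply, vecComponent_apply,
      vecComponent_apply, Pi.smul_apply, smul_eq_mul, smul_eq_mul, mul_comm (X i),
      mul_comm (X i), (isHomogeneous_X K i).homogeneousComponent_add_mul]

/-- Each application of the contraction for one variable replaces the cycle by a homologous one free
of that variable, and variables already removed do not return. -/
theorem exists_koszulD_eq_sub_restrict (A : Finset σ) {a : ℕ}
    {c : Finset σ → ι → MvPolynomial σ K} (hc : koszulD (K := K) c = 0)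
    (hca : ∀ T, VecHomogeneous a (c T)) :
    ∃ u e : Finset σ → ι → MvPolynomial σ K, koszulD (K := K) u = c - e ∧
      (∀ T, VecHomogeneous a (e T)) ∧
      ∀ T k m, ∀ x ∈ A, m x ≠ 0 → coeff m (e T k) = 0 := by
  induction A using Finset.induction_on with
  | empty => exact ⟨0, c, by simp, hca, by simp⟩
  | insert x A _ ih =>
    obtain ⟨u, e, hu, he, hA⟩ := ih
    have he0 : koszulD (K := K) e = 0 := by
      rw [← sub_sub_cancel c e, ← hu, map_sub, hc, koszulD_koszulD, sub_zero]
    refine ⟨u + koszulContract x (vecDiv x) e, koszulRestrict x (vecMod x) e, ?_, ?_, ?_⟩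
    · rw [map_add, hu, koszulD_koszulContract (divisionBy_vecDiv_vecMod x) he0]
      abel
    · intro T
      unfold koszulRestrict
      split_ifs
      · exact fun _ => isHomogeneous_zero _ _ _
      · exact (he T).vecMod x
    · intro T k m y hy hm
      unfold koszulRestrict
      split_ifs
      · simp
      · rw [coeff_vecMod]
        split_ifs with hx
        · rcases Finset.mem_insert.mp hy with rfl | hy
          · exact absurd hx hm
          · exact hA T k m y hy hm
        · rfl

/-- The Koszul complex of a free module is exact in positive internal degrees. -/
theorem exists_koszulD_eq_of_vecHomogeneous {a : ℕ} (ha : a ≠ 0)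
    {c : Finset σ → ι → MvPolynomial σ K} (hc : koszulD (K := K) c = 0)
    (hca : ∀ T, VecHomogeneous a (c T)) :
    ∃ u : Finset σ → ι → MvPolynomial σ K, koszulD (K := K) u = c := by
  obtain ⟨u, e, hu, he, h⟩ := exists_koszulD_eq_sub_restrict Finset.univ hc hca
  refine ⟨u, ?_⟩
  rw [hu, sub_eq_self]
  funext T k
  ext m
  rw [Pi.zero_apply, Pi.zero_apply, coeff_zero]
  -- After all variables are removed only constant terms could survive, and these are excluded by `a
  -- ≠ 0`.
  by_cases hm : m = 0
  · subst hm
    by_contra h0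
    have := he T k h0
    simp at this
    exact ha this.symm
  · obtain ⟨x, hx⟩ := Finsupp.ne_iff.mp hm
    exact h T k m x (Finset.mem_univ x) hx

end Acyclic

/-! ### Linear resolutions and Koszul homology -/

section RankOne

variable {σ K : Type*} [Field K]

/-- An ideal as a submodule of the free module of rank one. -/
noncomputable def idealVec (J : Ideal (MvPolynomial σ K)) :
    Submodule (MvPolynomial σ K) (Unit → MvPolynomial σ K) :=
  Submodule.comap (LinearMap.proj ()) J

theorem mem_idealVec {J : Ideal (MvPolynomial σ K)} {v : Unit → MvPolynomial σ K} :
    v ∈ idealVec J ↔ v () ∈ J := Iff.rfl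

theorem linearCombination_apply_unit {s : ℕ} (g : Fin s → Unit → MvPolynomial σ K)
    (u : Fin s → MvPolynomial σ K) :
    Fintype.linearCombination (MvPolynomial σ K) g u () =
      Fintype.linearCombination (MvPolynomial σ K) (fun j => g j ()) u := by
  rw [linearCombination_apply_apply, Fintype.linearCombination_apply]
  rfl

theorem range_linearCombination_eq_idealVec {s : ℕ} (g : Fin s → Unit → MvPolynomial σ K) :
    LinearMap.range (Fintype.linearCombination (MvPolynomial σ K) g) =
      idealVec (Ideal.span (Set.range fun j => g j ())) := by
  ext v
  rw [mem_idealVec, Ideal.span, ← Fintype.range_linearCombination, LinearMap.mem_range,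
    LinearMap.mem_range]
  refine exists_congr fun u => ?_
  rw [← linearCombination_apply_unit]
  exact ⟨fun h => congrFun h (), fun h => _root_.funext fun _ => h⟩

theorem linearCombination_unit_eq_zero_iff {s : ℕ} (g : Fin s → Unit → MvPolynomial σ K)
    (u : Fin s → MvPolynomial σ K) :
    Fintype.linearCombination (MvPolynomial σ K) g u = 0 ↔
      Fintype.linearCombination (MvPolynomial σ K) (fun j => g j ()) u = 0 := by
  rw [← linearCombination_apply_unit]
  exact ⟨fun h => congrFun h (), fun h => _root_.funext fun _ => h⟩

theorem mulVecLin_eq_linearCombination {r s : ℕ}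
    (A : Matrix (Fin r) (Fin s) (MvPolynomial σ K)) :
    A.mulVecLin = Fintype.linearCombination (MvPolynomial σ K) fun c r => A r c := by
  refine LinearMap.ext fun v => _root_.funext fun k => ?_
  rw [linearCombination_apply_apply, Matrix.mulVecLin_apply, Matrix.mulVec, dotProduct]
  exact Finset.sum_congr rfl fun j _ => mul_comm _ _

end RankOne

section Linear

variable {σ K ι : Type*} [Field K] [Fintype σ] [LinearOrder σ]

/-- The Koszul homology of the graded submodule `N` of a free module in homological degrees less
than `p` is concentrated in coefficient degree `d`. -/
def KoszulLinearBelow (p : ℕ) (N : Submodule (MvPolynomial σ K) (ι → MvPolynomial σ K)) (d : ℕ) :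
    Prop :=
  ∀ a, a ≠ d → ∀ c : Finset σ → ι → MvPolynomial σ K, (∀ T, c T ∈ N) →
    (∀ T, VecHomogeneous a (c T)) → (∀ T : Finset σ, p ≤ T.card → c T = 0) →
    koszulD (K := K) c = 0 → ∃ w, (∀ T, w T ∈ N) ∧ koszulD (K := K) w = c

/-- The Koszul homology of the graded submodule `N` of a free module is concentrated in coefficient
degree `d`. -/
def KoszulLinear (N : Submodule (MvPolynomial σ K) (ι → MvPolynomial σ K)) (d : ℕ) : Prop :=
  ∀ a, a ≠ d → ∀ c : Finset σ → ι → MvPolynomial σ K, (∀ T, c T ∈ N) →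
    (∀ T, VecHomogeneous a (c T)) → koszulD (K := K) c = 0 →
      ∃ w, (∀ T, w T ∈ N) ∧ koszulD (K := K) w = c

theorem koszulLinearBelow_zero (N : Submodule (MvPolynomial σ K) (ι → MvPolynomial σ K)) (d : ℕ) :
    KoszulLinearBelow 0 N d := fun _ _ c _ _ h _ =>
  ⟨0, fun _ => N.zero_mem, by rw [map_zero]; exact (funext fun T => h T (Nat.zero_le _)).symm⟩

theorem koszulLinear_of_below {N : Submodule (MvPolynomial σ K) (ι → MvPolynomial σ K)} {d : ℕ}
    (h : ∀ p, KoszulLinearBelow p N d) : KoszulLinear N d := fun a ha c hN hc h0 =>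
  -- No set of variables has more than `Fintype.card σ` elements, so this bound imposes nothing.
  h (Fintype.card σ + 1) a ha c hN hc
    (fun T hT => absurd (Finset.card_le_univ T) (by omega)) h0

/-! ### Dimension shifting between a module and its syzygies -/

section Syzygies

variable {κ : Type*} [Fintype κ] {g : κ → ι → MvPolynomial σ K} {d : ℕ}

/-- The connecting homomorphism: lift a cycle to the free module and take its boundary, a cycle of
syzygies one homological degree lower. If that bounds among the syzygies, correcting the lift makes
it a cycle, which bounds in the free module. -/
theorem koszulLinearBelow_succ_of_ker (hg : ∀ j, VecHomogeneous d (g j)) {p : ℕ}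
    (h : KoszulLinearBelow p
      (LinearMap.ker (Fintype.linearCombination (MvPolynomial σ K) g)) 1) :
    KoszulLinearBelow (p + 1)
      (LinearMap.range (Fintype.linearCombination (MvPolynomial σ K) g)) d := by
  set π := Fintype.linearCombination (MvPolynomial σ K) g with hπ
  intro a had c hcN hca hcp hc
  rcases lt_or_ge a d with hlt | hge
  · refine ⟨0, fun _ => Submodule.zero_mem _, ?_⟩
    rw [map_zero]
    funext T
    obtain ⟨v, hv⟩ := hcN T
    rw [← (hca T).vecComponent_eq, ← hv, vecComponent_linearCombination_of_lt hg v hlt]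
    rfl
  obtain ⟨b, rfl⟩ := Nat.exists_eq_add_of_le' hge
  have hb : b ≠ 0 := by rintro rfl; simp at had
  choose l hl using fun v : ι → MvPolynomial σ K =>
    exists_linearCombination_eq_of_vecHomogeneous hg (a := b) v
  have hlb := fun T => (hl (c T) (hcN T) (hca T)).1
  have hlπ : ∀ T, π (l (c T)) = c T := fun T => (hl (c T) (hcN T) (hca T)).2.1
  have hl0 := fun T => (hl (c T) (hcN T) (hca T)).2.2
  have hbound : koszulD (K := K) (fun T => vecComponent b (l (c T))) =
      koszulD (K := K) (fun T => l (c T)) := by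
    congr 1
    exact funext fun T => (hlb T).vecComponent_eq
  rw [koszulD_vecComponent] at hbound
  -- The differential raises the coefficient degree to `b + 1`, which differs from 1 because `b ≠
  -- 0`.
  obtain ⟨w, hw, hwD⟩ := h (b + 1) (by omega) (koszulD (K := K) fun T => l (c T))
    (fun T => by
      rw [LinearMap.mem_ker, ← congrFun (koszulD_map π fun T => l (c T)) T]
      simp only [hlπ]
      rw [show koszulD (K := K) (fun T => c T) = 0 from hc]
      rfl)
    (fun T => by rw [← hbound]; exact vecHomogeneous_vecComponent _ _)
    (koszulD_eq_zero_of_card fun T hT => hl0 T (hcp T hT))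
    (koszulD_koszulD _)
  have hwD' : koszulD (K := K) (fun T => vecComponent b (w T)) =
      koszulD (K := K) fun T => l (c T) := by
    rw [koszulD_vecComponent, hwD, hbound]
  -- Since `w` need not be homogeneous, only the component of degree `b` of the corrected lift is
  -- used.
  obtain ⟨u, hu⟩ := exists_koszulD_eq_of_vecHomogeneous (K := K) hb
    (c := fun T => vecComponent b (l (c T) - w T))
    (by
      rw [koszulD_vecComponent]
      funext T
      have : koszulD (K := K) (fun T => l (c T) - w T) = 0 := by
        change koszulD (K := K) ((fun T => l (c T)) - w) = 0
        rw [map_sub, hwD, sub_self]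
      rw [this]
      simp)
    (fun T => vecHomogeneous_vecComponent _ _)
  refine ⟨fun T => π (u T), fun T => ⟨u T, rfl⟩, ?_⟩
  rw [koszulD_map, hu]
  funext T
  rw [linearCombination_vecComponent hg, map_sub, hw T, sub_zero, hlπ, (hca T).vecComponent_eq]

/-- The same shift read backwards: a cycle of syzygies bounds some u in the free module, the image
of u is a cycle in the range, and a chain bounding that image lifts to a correction that moves u
into the syzygies. Independence over `K` handles coefficient degree 0, where a syzygy is a
`K`-linear relation. -/
theorem koszulLinear_ker (hg : ∀ j, VecHomogeneous d (g j)) (hind : LinearIndependent K g)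
    (h : KoszulLinear (LinearMap.range (Fintype.linearCombination (MvPolynomial σ K) g)) d) :
    KoszulLinear (LinearMap.ker (Fintype.linearCombination (MvPolynomial σ K) g)) 1 := by
  set π := Fintype.linearCombination (MvPolynomial σ K) g with hπ
  intro b hb c hcN hcb hc
  rcases Nat.eq_zero_or_pos b with rfl | hpos
  · refine ⟨0, fun _ => Submodule.zero_mem _, ?_⟩
    rw [map_zero]
    funext T j
    have hC : ∀ j, c T j = C (coeff 0 (c T j)) := fun j =>
      (totalDegree_eq_zero_iff_eq_C).mp (Nat.le_zero.mp (hcb T j).totalDegree_le)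
    have h0 : ∑ j, coeff 0 (c T j) • g j = 0 := by
      have := hcN T
      rw [LinearMap.mem_ker, hπ, Fintype.linearCombination_apply] at this
      rw [← this]
      refine Finset.sum_congr rfl fun j _ => ?_
      conv_rhs => rw [hC j]
      rw [← algebraMap_eq, algebraMap_smul]
    rw [hC j, Fintype.linearIndependent_iff.mp hind _ h0 j, map_zero]
    rfl
  obtain ⟨e, rfl⟩ := Nat.exists_eq_add_of_le' hpos
  obtain ⟨u', hu'⟩ := exists_koszulD_eq_of_vecHomogeneous (K := K) hpos.ne' hc hcb
  set u := fun T => vecComponent e (u' T) with hudef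
  have hu : koszulD (K := K) u = c := by
    rw [hudef, koszulD_vecComponent, hu']
    exact funext fun T => (hcb T).vecComponent_eq
  -- Here `e ≠ 0` because the coefficient degree `e + 1` is not 1, so `e + d ≠ d`.
  obtain ⟨w, hwN, hwD⟩ := h (e + d) (by omega) (fun T => π (u T)) (fun T => ⟨u T, rfl⟩)
    (fun T => (vecHomogeneous_vecComponent _ _).linearCombination hg)
    (by rw [koszulD_map, hu]; exact funext hcN)
  choose l hl using hwN
  have hlw : (fun T => π (l T)) = w := funext hl
  refine ⟨u - koszulD (K := K) l, fun T => ?_, ?_⟩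
  · rw [LinearMap.mem_ker, Pi.sub_apply, map_sub, ← congrFun (koszulD_map π l) T, hlw, hwD,
      sub_self]
  · rw [map_sub, hu, koszulD_koszulD, sub_zero]

end Syzygies

theorem vecComponent_zero_koszulD (c : Finset σ → ι → MvPolynomial σ K) (T : Finset σ) :
    vecComponent 0 (koszulD (K := K) c T) = 0 := by
  funext k
  rw [koszulD_apply, map_sum, Finset.sum_apply]
  refine Finset.sum_eq_zero fun i _ => ?_
  split_ifs
  · simp
  · rw [map_zsmul, Pi.smul_apply, vecComponent_apply, Pi.smul_apply, smul_eq_mul, mul_comm (X i),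
      (isHomogeneous_X K i).homogeneousComponent_mul_eq_zero _ zero_lt_one, smul_zero]

/-- Koszul homology in homological degree 0 is N modulo the variables times N. Outside degree `d`,
an element is thus a combination of elements of N one degree lower with the variables as
coefficients. -/
theorem KoszulLinear.mem_span_of_vecHomogeneous
    {N : Submodule (MvPolynomial σ K) (ι → MvPolynomial σ K)} {d : ℕ} (hN : IsGraded N)
    (h : KoszulLinear N d) (a : ℕ) : ∀ v ∈ N, VecHomogeneous a v →
      v ∈ Submodule.span (MvPolynomial σ K) {v | v ∈ N ∧ VecHomogeneous d v} := by
  induction a with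
  | zero =>
    intro v hv hva
    rcases eq_or_ne 0 d with rfl | hd
    · exact Submodule.subset_span ⟨hv, hva⟩
    obtain ⟨w, -, hw⟩ := h 0 hd (fun T => if T = ∅ then v else 0)
      (fun T => by split_ifs <;> simp [hv])
      (fun T => by split_ifs; exacts [hva, fun _ => isHomogeneous_zero _ _ _])
      (by funext T; simp [koszulD_apply])
    have := vecComponent_zero_koszulD w ∅
    simp only [hw, if_true, hva.vecComponent_eq] at this
    rw [this]
    exact Submodule.zero_mem _
  | succ e ih =>
    intro v hv hva
    rcases eq_or_ne (e + 1) d with rfl | hd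
    · exact Submodule.subset_span ⟨hv, hva⟩
    obtain ⟨w, hwN, hw⟩ := h (e + 1) hd (fun T => if T = ∅ then v else 0)
      (fun T => by split_ifs <;> simp [hv])
      (fun T => by split_ifs; exacts [hva, fun _ => isHomogeneous_zero _ _ _])
      (by funext T; simp [koszulD_apply])
    have := congrFun (koszulD_vecComponent w e) ∅
    simp only [hw, if_true, hva.vecComponent_eq] at this
    rw [← this]
    exact koszulD_mem (fun T => ih _ (hN _ (hwN T) e) (vecHomogeneous_vecComponent _ _)) ∅

theorem KoszulLinear.span_eq [Finite ι]
    {N : Submodule (MvPolynomial σ K) (ι → MvPolynomial σ K)} {d : ℕ} (hN : IsGraded N)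
    (h : KoszulLinear N d) :
    Submodule.span (MvPolynomial σ K) {v | v ∈ N ∧ VecHomogeneous d v} = N := by
  refine le_antisymm (Submodule.span_le.mpr fun v hv => hv.1) fun v hv => ?_
  obtain ⟨m, hm⟩ := exists_sum_vecComponent v
  rw [← hm]
  exact Submodule.sum_mem _ fun a _ => h.mem_span_of_vecHomogeneous hN a _ (hN v hv a)
    (vecHomogeneous_vecComponent _ _)

/-- A graded submodule with linear Koszul homology in degree `d` is minimally generated by finitely
many elements of degree `d`. -/
theorem KoszulLinear.exists_generators [Finite ι]
    {N : Submodule (MvPolynomial σ K) (ι → MvPolynomial σ K)} {d : ℕ} (hN : IsGraded N)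
    (h : KoszulLinear N d) :
    ∃ (s : ℕ) (g : Fin s → ι → MvPolynomial σ K), (∀ j, VecHomogeneous d (g j)) ∧
      LinearIndependent K g ∧
      LinearMap.range (Fintype.linearCombination (MvPolynomial σ K) g) = N := by
  let H : Submodule K (ι → MvPolynomial σ K) :=
    Submodule.pi Set.univ fun _ => homogeneousSubmodule σ K d
  let P : Submodule K (ι → MvPolynomial σ K) := N.restrictScalars K ⊓ H
  have hP : ∀ v, v ∈ P ↔ v ∈ N ∧ VecHomogeneous d v := fun v => by
    simp [P, H, Submodule.mem_pi, VecHomogeneous]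
  have hH : FiniteDimensional K H :=
    Module.Finite.iff_fg.mpr (Submodule.fg_pi fun _ => homogeneousSubmodule_fg σ K d)
  have : FiniteDimensional K P := Submodule.finiteDimensional_of_le inf_le_right
  -- A `K`-basis of the degree-`d` part of `N` generates, and being a basis makes the generators
  -- minimal.
  let b := Module.finBasis K P
  refine ⟨_, fun j => (b j : ι → MvPolynomial σ K), fun j => ((hP _).mp (b j).2).2,
    b.linearIndependent.map' P.subtype (Submodule.ker_subtype P), ?_⟩
  rw [Fintype.range_linearCombination]
  refine le_antisymm (Submodule.span_le.mpr ?_) ?_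
  · rintro _ ⟨j, rfl⟩
    exact ((hP _).mp (b j).2).1
  · conv_lhs => rw [← h.span_eq hN]
    refine Submodule.span_le.mpr fun v hv => ?_
    have hv' := b.sum_repr ⟨v, (hP v).mpr hv⟩
    have hv'' := congrArg P.subtype hv'
    rw [map_sum, Submodule.subtype_apply] at hv''
    change _ = v at hv''
    rw [← hv'']
    refine Submodule.sum_mem _ fun j _ => ?_
    rw [map_smul]
    exact Submodule.smul_of_tower_mem _ _ (Submodule.subset_span ⟨j, rfl⟩)

/-! ### Construction of linear resolutions -/

/-- A graded submodule of a finite free module whose Koszul homology is concentrated in coefficient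
degree one. -/
structure LinearSyzygies (σ K : Type*) [Field K] [Fintype σ] [LinearOrder σ] where
  /-- The rank of the ambient free module. -/
  rank : ℕ
  /-- The submodule. -/
  module : Submodule (MvPolynomial σ K) (Fin rank → MvPolynomial σ K)
  isGraded : IsGraded module
  koszulLinear : KoszulLinear module 1

theorem KoszulLinear.exists_linearSyzygies [Finite ι]
    {N : Submodule (MvPolynomial σ K) (ι → MvPolynomial σ K)} {d : ℕ} (hN : IsGraded N)
    (h : KoszulLinear N d) :
    ∃ (S : LinearSyzygies σ K) (g : Fin S.rank → ι → MvPolynomial σ K),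
      (∀ j, VecHomogeneous d (g j)) ∧
      LinearMap.range (Fintype.linearCombination (MvPolynomial σ K) g) = N ∧
      LinearMap.ker (Fintype.linearCombination (MvPolynomial σ K) g) = S.module := by
  obtain ⟨s, g, hg, hind, hr⟩ := h.exists_generators hN
  exact ⟨⟨s, _, isGraded_ker_linearCombination hg, koszulLinear_ker hg hind (hr ▸ h)⟩, g, hg, hr,
    rfl⟩

namespace LinearSyzygies

theorem exists_next (S : LinearSyzygies σ K) :
    ∃ (S' : LinearSyzygies σ K) (g : Fin S'.rank → Fin S.rank → MvPolynomial σ K),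
      (∀ j, VecHomogeneous 1 (g j)) ∧
      LinearMap.range (Fintype.linearCombination (MvPolynomial σ K) g) = S.module ∧
      LinearMap.ker (Fintype.linearCombination (MvPolynomial σ K) g) = S'.module :=
  S.koszulLinear.exists_linearSyzygies S.isGraded

/-- The module of relations among minimal generators. -/
noncomputable def next (S : LinearSyzygies σ K) : LinearSyzygies σ K := S.exists_next.choose

/-- The matrix of minimal generators. -/
noncomputable def matrix (S : LinearSyzygies σ K) :
    Matrix (Fin S.rank) (Fin S.next.rank) (MvPolynomial σ K) :=
  fun r c => S.exists_next.choose_spec.choose c r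

theorem matrix_isHomogeneous (S : LinearSyzygies σ K) (r c) : (S.matrix r c).IsHomogeneous 1 :=
  S.exists_next.choose_spec.choose_spec.1 c r

theorem mulVecLin_matrix (S : LinearSyzygies σ K) : S.matrix.mulVecLin =
    Fintype.linearCombination (MvPolynomial σ K) S.exists_next.choose_spec.choose :=
  mulVecLin_eq_linearCombination _

theorem range_mulVecLin_matrix (S : LinearSyzygies σ K) :
    LinearMap.range S.matrix.mulVecLin = S.module := by
  rw [mulVecLin_matrix]
  exact S.exists_next.choose_spec.choose_spec.2.1

theorem ker_mulVecLin_matrix (S : LinearSyzygies σ K) :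
    LinearMap.ker S.matrix.mulVecLin = S.next.module := by
  rw [mulVecLin_matrix]
  exact S.exists_next.choose_spec.choose_spec.2.2

/-- The sequence of iterated syzygy modules. -/
noncomputable def iterate (S : LinearSyzygies σ K) : ℕ → LinearSyzygies σ K
  | 0 => S
  | i + 1 => (S.iterate i).next

end LinearSyzygies

theorem hasLinearResolution_of_koszulLinear {J : Ideal (MvPolynomial σ K)} {d : ℕ}
    (hJ : IsGraded (idealVec J)) (h : KoszulLinear (idealVec J) d) : HasLinearResolution J d := by
  obtain ⟨S, g, hg, hr, hk⟩ := h.exists_linearSyzygies hJ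
  have hspan : Ideal.span (Set.range fun j => g j ()) = J := by
    rw [range_linearCombination_eq_idealVec] at hr
    ext f
    exact SetLike.ext_iff.mp hr fun _ => f
  have hzero : Function.Exact S.matrix.mulVecLin
      (Fintype.linearCombination (MvPolynomial σ K) fun j => g j ()) := by
    intro u
    rw [← linearCombination_unit_eq_zero_iff, ← LinearMap.mem_ker, hk, ← LinearMap.coe_range,
      SetLike.mem_coe, S.range_mulVecLin_matrix]
  have hsucc : ∀ T : LinearSyzygies σ K,
      Function.Exact T.next.matrix.mulVecLin T.matrix.mulVecLin := by
    intro T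
    rw [LinearMap.exact_iff, T.ker_mulVecLin_matrix, T.next.range_mulVecLin_matrix]
  exact ⟨{
    rank := fun i => (S.iterate i).rank
    gen := fun j => g j ()
    diff := fun i => (S.iterate i).matrix
    gen_isHomogeneous := fun j => hg j ()
    diff_isHomogeneous := fun i => (S.iterate i).matrix_isHomogeneous
    span_gen := hspan
    exact_zero := hzero
    exact_succ := fun i => hsucc (S.iterate i) }⟩

theorem LinearResolution.koszulLinear {J : Ideal (MvPolynomial σ K)} {d : ℕ}
    (F : LinearResolution J d) : KoszulLinear (idealVec J) d := by
  -- The resolution may be infinite, so the induction is on the homological bound `p`, for all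
  -- syzygy modules at once.
  have key : ∀ p i, KoszulLinearBelow p (LinearMap.range (F.diff i).mulVecLin) 1 := by
    intro p
    induction p with
    | zero => exact fun i => koszulLinearBelow_zero _ _
    | succ p ih =>
      intro i
      rw [mulVecLin_eq_linearCombination]
      refine koszulLinearBelow_succ_of_ker (fun c r => F.diff_isHomogeneous i r c) ?_
      rw [← mulVecLin_eq_linearCombination, LinearMap.exact_iff.mp (F.exact_succ i)]
      exact ih (i + 1)
  refine koszulLinear_of_below fun p => ?_
  cases p with
  | zero => exact koszulLinearBelow_zero _ _
  | succ p =>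
    have hr := range_linearCombination_eq_idealVec fun j (_ : Unit) => F.gen j
    rw [F.span_gen] at hr
    rw [← hr]
    refine koszulLinearBelow_succ_of_ker (fun j _ => F.gen_isHomogeneous j) ?_
    have hk : LinearMap.ker (Fintype.linearCombination (MvPolynomial σ K)
        fun j (_ : Unit) => F.gen j) = LinearMap.range (F.diff 0).mulVecLin := by
      rw [← LinearMap.exact_iff.mp F.exact_zero]
      ext u
      rw [LinearMap.mem_ker, linearCombination_unit_eq_zero_iff, LinearMap.mem_ker]
    rw [hk]
    exact key p 0

end Linear

/-! ### Monomial ideals -/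

section MonomialIdeal

variable {σ K : Type*} [Field K]

/-- The ideal generated by the monomials with exponent vectors in `S`. -/
noncomputable def monomialSpan (K : Type*) [Field K] (S : Set (σ →₀ ℕ)) :
    Ideal (MvPolynomial σ K) :=
  Ideal.span ((fun a => monomial a (1 : K)) '' S)

theorem monomial_mem_monomialSpan {S : Set (σ →₀ ℕ)} {b : σ →₀ ℕ} :
    monomial b (1 : K) ∈ monomialSpan K S ↔ ∃ s ∈ S, s ≤ b := by
  classical
  rw [monomialSpan, mem_ideal_span_monomial_image]
  simp [support_monomial]

theorem mem_monomialSpan {S : Set (σ →₀ ℕ)} {f : MvPolynomial σ K} :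
    f ∈ monomialSpan K S ↔ ∀ b, coeff b f ≠ 0 → ∃ s ∈ S, s ≤ b := by
  rw [monomialSpan, mem_ideal_span_monomial_image]
  simp only [mem_support_iff]

theorem MvPolynomial.IsHomogeneous.degree_eq_of_coeff_ne_zero {f : MvPolynomial σ K} {a : ℕ}
    (hf : f.IsHomogeneous a) {b : σ →₀ ℕ} (hb : coeff b f ≠ 0) : b.degree = a := by
  rw [Finsupp.degree_eq_weight_one]
  exact hf hb

theorem homogeneousComponent_mem_monomialSpan {S : Set (σ →₀ ℕ)} {f : MvPolynomial σ K}
    (hf : f ∈ monomialSpan K S) (k : ℕ) : homogeneousComponent k f ∈ monomialSpan K S := by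
  rw [mem_monomialSpan] at hf ⊢
  intro b hb
  rw [coeff_homogeneousComponent] at hb
  exact hf b fun h => hb (by simp [h])

theorem isGraded_idealVec_monomialSpan (S : Set (σ →₀ ℕ)) :
    IsGraded (idealVec (monomialSpan K S)) := fun _ hv a =>
  homogeneousComponent_mem_monomialSpan hv a

theorem degreePartIdeal_monomialSpan (S : Set (σ →₀ ℕ)) (d : ℕ) :
    degreePartIdeal (monomialSpan K S) d =
      monomialSpan K {b | (∃ s ∈ S, s ≤ b) ∧ b.degree = d} := by
  refine le_antisymm (Ideal.span_le.mpr ?_) (Ideal.span_le.mpr ?_)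
  · rintro f ⟨hf, hfd⟩
    refine mem_monomialSpan.mpr fun b hb => ⟨b, ⟨mem_monomialSpan.mp hf b hb,
      hfd.degree_eq_of_coeff_ne_zero hb⟩, le_rfl⟩
  · rintro _ ⟨b, ⟨hb, hbd⟩, rfl⟩
    exact Ideal.subset_span ⟨monomial_mem_monomialSpan.mpr hb, isHomogeneous_monomial _ hbd⟩

theorem exists_le_le_degree_eq {u b : σ →₀ ℕ} (hub : u ≤ b) {d : ℕ} (hu : u.degree ≤ d)
    (hb : d ≤ b.degree) : ∃ v, u ≤ v ∧ v ≤ b ∧ v.degree = d := by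
  classical
  induction d, hu using Nat.le_induction with
  | base => exact ⟨u, le_rfl, hub, rfl⟩
  | succ e _ ih =>
    obtain ⟨v, huv, hvb, hv⟩ := ih (by omega)
    have hne : v ≠ b := by rintro rfl; omega
    obtain ⟨i, hi⟩ : ∃ i, v i < b i := by
      by_contra! h
      exact hne (le_antisymm hvb h)
    refine ⟨v + Finsupp.single i 1, huv.trans le_self_add, fun j => ?_, by
      rw [map_add, hv, Finsupp.degree_single]⟩
    rcases eq_or_ne i j with rfl | hij
    · simpa using hi
    · simpa [Finsupp.single_apply, hij] using hvb j

/-- An x-free monomial of the ideal is a multiple of a minimal generator, which is then also x-free.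
-/
theorem span_minimalGenerators_diff [Finite σ] (S : Set (σ →₀ ℕ)) (x : σ) :
    Ideal.span (minimalGenerators (monomialSpan K S) \
      {u | u ∈ minimalGenerators (monomialSpan K S) ∧ (X x : MvPolynomial σ K) ∣ u}) =
    monomialSpan K {b | (∃ s ∈ S, s ≤ b) ∧ b x = 0} := by
  have hdvd : ∀ a : σ →₀ ℕ, (X x : MvPolynomial σ K) ∣ monomial a (1 : K) ↔ a x ≠ 0 := fun a => by
    simp [X_dvd_monomial]
  refine le_antisymm (Ideal.span_le.mpr ?_) (Ideal.span_le.mpr ?_)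
  · rintro _ ⟨⟨a, ha, rfl⟩, hn⟩
    have ha' : monomial a (1 : K) ∈ monomialSpan K S := ha.1
    refine Ideal.subset_span ⟨a, ⟨monomial_mem_monomialSpan.mp ha', ?_⟩, rfl⟩
    by_contra hx
    exact hn ⟨⟨a, ha, rfl⟩, (hdvd a).mpr hx⟩
  · rintro _ ⟨b, ⟨hb, hbx⟩, rfl⟩
    obtain ⟨a, hab, ha⟩ := exists_minimal_le_of_wellFoundedLT
      (fun b : σ →₀ ℕ => monomial b (1 : K) ∈ monomialSpan K S) b
      (monomial_mem_monomialSpan.mpr hb)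
    have hax : a x = 0 := Nat.le_zero.mp (hbx ▸ hab x)
    refine Ideal.mem_of_dvd _ (monomial_one_dvd_monomial_one.mpr hab)
      (Ideal.subset_span ⟨⟨a, ha, rfl⟩, fun h => (hdvd a).mp h.2 hax⟩)

variable [Fintype σ] [LinearOrder σ]

/-- Two monomial ideals with the same part of degree zero in `x`, the smaller of which is closed
under division by `x` in degrees above `d`. Linearity in degree `d` passes to the smaller one. -/
theorem KoszulLinear.of_vecDiv_mem {ι : Type*}
    {N N' : Submodule (MvPolynomial σ K) (ι → MvPolynomial σ K)} {d : ℕ} (x : σ)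
    (h : KoszulLinear N d) (hle : N' ≤ N) (hmod : ∀ v ∈ N, vecMod x v ∈ N')
    (hlow : ∀ a < d, ∀ v ∈ N', VecHomogeneous a v → v = 0)
    (hdiv : ∀ a > d, ∀ v ∈ N', VecHomogeneous a v → vecDiv x v ∈ N') : KoszulLinear N' d := by
  intro a ha c hcN hca hc
  rcases lt_or_gt_of_ne ha with hlt | hgt
  · exact ⟨0, fun _ => N'.zero_mem, by
      rw [map_zero]; exact (_root_.funext fun T => hlow a hlt _ (hcN T) (hca T)).symm⟩
  have hdb := divisionBy_vecDiv_vecMod (K := K) (ι := ι) x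
  have hmem : ∀ {c : Finset σ → ι → MvPolynomial σ K}, (∀ T, c T ∈ N) →
      ∀ T, koszulRestrict x (vecMod x) c T ∈ N' := fun hc T => by
    unfold koszulRestrict
    split_ifs
    · exact N'.zero_mem
    · exact hmod _ (hc T)
  obtain ⟨w, hwN, hw⟩ := h a ha (koszulRestrict x (vecMod x) c)
    (fun T => hle (hmem (fun T => hle (hcN T)) T))
    (fun T => by
      unfold koszulRestrict
      split_ifs
      · exact fun _ => isHomogeneous_zero _ _ _
      · exact (hca T).vecMod x)
    (by rw [koszulD_koszulRestrict hdb, hc]; funext T; simp [koszulRestrict])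
  refine ⟨koszulContract x (vecDiv x) c + koszulRestrict x (vecMod x) w,
    fun T => N'.add_mem ?_ (hmem hwN T), ?_⟩
  · unfold koszulContract
    split_ifs
    · exact zsmul_mem (hdiv a hgt _ (hcN _) (hca _)) _
    · exact N'.zero_mem
  -- Restricting `w` restricts its boundary, which is already a restriction and so is unchanged.
  · have hidem : koszulRestrict x (vecMod x) (koszulRestrict x (vecMod x) c) =
        koszulRestrict x (vecMod x) c := by
      funext T k
      ext m
      unfold koszulRestrict
      split_ifs
      · rfl
      · simp only [coeff_vecMod]
        split_ifs <;> rfl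
    rw [map_add, koszulD_koszulContract hdb hc, koszulD_koszulRestrict hdb, hw, hidem,
      sub_add_cancel]

theorem koszulLinear_degreePartIdeal_of_exponent_eq_zero (S : Set (σ →₀ ℕ)) (x : σ) (d : ℕ)
    (h : KoszulLinear (idealVec (degreePartIdeal (monomialSpan K S) d)) d) :
    KoszulLinear (idealVec (degreePartIdeal
      (monomialSpan K {b | (∃ s ∈ S, s ≤ b) ∧ b x = 0}) d)) d := by
  rw [degreePartIdeal_monomialSpan] at h ⊢
  refine h.of_vecDiv_mem x ?_ ?_ ?_ ?_
  · intro v hv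
    rw [mem_idealVec, mem_monomialSpan] at hv ⊢
    intro b hb
    obtain ⟨t, ⟨⟨u, ⟨⟨s, hs, hsu⟩, -⟩, hut⟩, htd⟩, htb⟩ := hv b hb
    exact ⟨t, ⟨⟨s, hs, hsu.trans hut⟩, htd⟩, htb⟩
  · intro v hv
    rw [mem_idealVec, mem_monomialSpan] at hv ⊢
    intro b hb
    rw [coeff_vecMod] at hb
    split_ifs at hb with hbx
    · obtain ⟨t, ⟨hst, htd⟩, htb⟩ := hv b hb
      exact ⟨t, ⟨⟨t, ⟨hst, Nat.le_zero.mp (hbx ▸ htb x)⟩, le_rfl⟩, htd⟩, htb⟩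
    · exact absurd rfl hb
  · intro a had v hv hva
    rw [mem_idealVec, mem_monomialSpan] at hv
    funext k
    ext b
    by_contra hb
    obtain ⟨t, ⟨-, htd⟩, htb⟩ := hv b hb
    have hba := (hva k).degree_eq_of_coeff_ne_zero hb
    have := Finsupp.degree_mono htb
    omega
  · intro a had v hv hva
    rw [mem_idealVec, mem_monomialSpan] at hv ⊢
    intro b hb
    rw [coeff_vecDiv] at hb
    obtain ⟨t, ⟨⟨u, ⟨hsu, hux⟩, hut⟩, htd⟩, htb⟩ := hv _ hb
    have hba := (hva ()).degree_eq_of_coeff_ne_zero hb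
    rw [map_add, Finsupp.degree_single] at hba
    have hub : u ≤ b := fun i => by
      rcases eq_or_ne x i with rfl | hi
      · simp [hux]
      · simpa [hi] using (hut.trans htb) i
    -- The exponent `b` has degree `a - 1 ≥ d`, so there is still room for a degree-`d` multiple of
    -- `u` dividing it. This is where `a > d` is needed.
    obtain ⟨w, huw, hwb, hwd⟩ := exists_le_le_degree_eq (d := d) hub
      (htd ▸ Finsupp.degree_mono hut) (by omega)
    exact ⟨w, ⟨⟨u, ⟨hsu, hux⟩, huw⟩, hwd⟩, hwb⟩

end MonomialIdeal

theorem proposition3p2 {K : Type*} [Field K] {n : ℕ} (I : Ideal (MvPolynomial (Fin n) K))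
    (hmon : IsMonomialIdeal I) (hI : IsComponentwiseLinear I) (x : Fin n) :
    IsComponentwiseLinear
      (Ideal.span (minimalGenerators I \
        {u | u ∈ minimalGenerators I ∧ (X x : MvPolynomial (Fin n) K) ∣ u})) := by
  obtain ⟨S, rfl⟩ := hmon
  change IsComponentwiseLinear (monomialSpan K S) at hI
  change IsComponentwiseLinear (Ideal.span (minimalGenerators (monomialSpan K S) \
    {u | u ∈ minimalGenerators (monomialSpan K S) ∧ (X x : MvPolynomial (Fin n) K) ∣ u}))
  rw [span_minimalGenerators_diff]
  refine ⟨fun f hf k => homogeneousComponent_mem_monomialSpan hf k, fun d => ?_⟩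
  obtain ⟨F⟩ := hI.2 d
  refine hasLinearResolution_of_koszulLinear ?_
    (koszulLinear_degreePartIdeal_of_exponent_eq_zero S x d F.koszulLinear)
  rw [degreePartIdeal_monomialSpan]
  exact isGraded_idealVec_monomialSpan _
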